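/- Both least sizes below exist, and $\mathfrak{hc} = \mathfrak{st}$. Here the uncountable Hadwiger conjecture number $\mathfrak{hc}$ is the least cardinality $|V|$ of the vertex set of a (simple, undirected) graph $G=(V,E)$ whose chromatic number is uncountable and which has no $K_{\omega_1}$ minor, and the special tree number $\mathfrak{st}$ is the least cardinality of a non-special tree with no uncountable branch. The chromatic number of $G$ is the least cardinal $\mu$ for which there is $c\colon V\to\mu$ with $c(u)\neq c(v)$ whenever $\{u,v\}\in E$. A graph $G$ has a $K_{\omega_1}$ minor if there are pairwise disjoint non-empty sets $X_\alpha\subseteq V$ ($\alpha<\omega_1$), each inducing a connected subgraph of $G$, such that for all $\alpha\ne\beta$ some edge of $G$ joins a vertex of $X_\alpha$ to a vertex of $X_\beta$. A tree is a partially ordered set $(T,\le)$ in which $\{s\in T : s<t\}$ is well-ordered for every $t\in T$; a branch is a maximal chain of $T$; and $T$ is special if there is a function $f\colon T\to\omega$ that is injective on every chain of $T$. -/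

import Mathlib

open Cardinal Ordinal

universe u v

namespace UncountableHadwiger

/-- The chromatic number of a graph as a cardinal: the least cardinal `μ` such that the graph has a
proper coloring with `μ` colors. (Mathlib's `SimpleGraph.chromaticNumber` is `ℕ∞`-valued and does
not distinguish infinite cardinals.) -/
noncomputable def chromaticCardinal {V : Type u} (G : SimpleGraph V) : Cardinal.{u} :=
  sInf {μ : Cardinal.{u} | ∃ C : Type u, #C = μ ∧ Nonempty (G.Coloring C)}

/-- `G` is a minor of `H`: there are pairwise disjoint non-empty vertex sets `X u` of `H`, indexed by
the vertices of `G`, each inducing a connected subgraph of `H` (`SimpleGraph.Connected` includes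
non-emptiness), such that adjacent vertices of `G` are sent to sets joined by an edge of `H`. -/
def IsMinor {V : Type u} {W : Type v} (G : SimpleGraph V) (H : SimpleGraph W) : Prop :=
  ∃ X : V → Set W,
    (∀ a b : V, a ≠ b → Disjoint (X a) (X b)) ∧
    (∀ a : V, (H.induce (X a)).Connected) ∧
    (∀ a b : V, G.Adj a b → ∃ x ∈ X a, ∃ y ∈ X b, H.Adj x y)

/-- The complete graph `K_{ω₁}`. -/
def completeOmegaOne : SimpleGraph (ω_ 1 : Ordinal.{u}).ToType :=
  SimpleGraph.completeGraph (ω_ 1 : Ordinal.{u}).ToType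

/-- A (set-theoretic) tree: a poset in which the predecessors of each element are well-ordered. -/
def IsSetTree (T : Type u) [PartialOrder T] : Prop :=
  ∀ t : T, IsWellOrder (Set.Iio t) (fun a b => a < b)

/-- A branch is a maximal chain. -/
def IsBranch {T : Type u} [PartialOrder T] (b : Set T) : Prop :=
  IsMaxChain (fun s t : T => s ≤ t) b

/-- A tree is special if there is a function `f : T → ω` which is injective on chains. -/
def IsSpecial (T : Type u) [PartialOrder T] : Prop :=
  ∃ f : T → ℕ, ∀ c : Set T, IsChain (fun s t : T => s ≤ t) c → Set.InjOn f c

/-- The sizes of the uncountably chromatic graphs with no `K_{ω₁}` minor. -/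
def hadwigerSizes : Set Cardinal.{u} :=
  {μ | ∃ (V : Type u) (G : SimpleGraph V),
    #V = μ ∧ ℵ₀ < chromaticCardinal G ∧ ¬ IsMinor completeOmegaOne.{u} G}

/-- The sizes of the non-special trees with no uncountable branch. -/
def specialTreeSizes : Set Cardinal.{u} :=
  {μ | ∃ (T : Type u) (_ : PartialOrder T),
    #T = μ ∧ IsSetTree T ∧ ¬ IsSpecial T ∧ ¬ ∃ b : Set T, IsBranch b ∧ ¬ b.Countable}

/-- The uncountable Hadwiger conjecture number `𝔥𝔠`. -/
noncomputable def hadwigerNumber : Cardinal.{u} := sInf hadwigerSizes.{u}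

/-- The special tree number `𝔰𝔱`. -/
noncomputable def specialTreeNumber : Cardinal.{u} := sInf specialTreeSizes.{u}

end UncountableHadwiger

/-!
A tree `T` gives its comparability graph: `T` is special exactly when this graph is countably
colorable, and every connected subgraph has a least element, so the branch sets of a `K_{ω₁}` minor
yield an uncountable chain.

Conversely, given a graph `G`, choose layers `U a`, `a < ω₁`: in every component `C` of what remains
before stage `a`, the layer `U a` is a countable connected set touching every earlier layer that `C`
touches. Follow a decreasing sequence of components, one for each stage. Unboundedly many layers are
touched by all later components of the sequence, since otherwise closing off gives a stage whose
component touches no layer between a fixed stage and itself, although these layers separate it from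
the rest of an earlier component. The corresponding parts of the layers are then pairwise
adjacent, a `K_{ω₁}` minor. Hence if `G` has none, every vertex lies in a layer, and the vertices,
ordered by being in the component of an earlier vertex, form a tree without uncountable chains in
which adjacent vertices are comparable.

A non-special tree without uncountable branches is given by the well-ordered sets of reals ordered
by end-extension: a specializing function gives a strictly increasing map to `ℝ`, and iterating such
a map along a maximal well-ordered set contradicts maximality.
-/

namespace UncountableHadwiger

section Trees

variable {T : Type*} [PartialOrder T]

theorem isSetTree_iff_exists_isLeast :
    IsSetTree T ↔ ∀ t : T, ∀ S ⊆ Set.Iio t, S.Nonempty → ∃ m, IsLeast S m := by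
  refine ⟨fun hT t S hSt ⟨x, hx⟩ => ?_, fun h t => { wf := ?_, trichotomous := ?_ }⟩
  · have := hT t
    obtain ⟨m, hmS, hmin⟩ := (hT t).wf.has_min (Subtype.val ⁻¹' S) ⟨⟨x, hSt hx⟩, hx⟩
    refine ⟨m, hmS, fun s hs => ?_⟩
    rcases trichotomous_of (fun a b : Set.Iio t => a < b) m ⟨s, hSt hs⟩ with hlt | heq | hgt
    · exact le_of_lt (α := T) hlt
    · exact (congrArg Subtype.val heq).le
    · exact absurd hgt (hmin _ hs)
  · refine WellFounded.wellFounded_iff_has_min.2 fun S hS => ?_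
    obtain ⟨_, ⟨m, hm, rfl⟩, hmin⟩ := h t (Subtype.val '' S)
      (Set.image_subset_iff.2 fun s _ => s.2) (hS.image _)
    exact ⟨m, hm, fun s hs => (hmin ⟨s, hs, rfl⟩).not_gt⟩
  · intro a b hab hba
    obtain ⟨m, hm, hmin⟩ := h t {a.1, b.1} (Set.pair_subset a.2 b.2) (Set.insert_nonempty _ _)
    refine Subtype.ext ?_
    rcases hm with rfl | rfl
    · exact (hmin (Or.inr rfl)).eq_of_not_lt hab
    · exact ((hmin (Or.inl rfl)).eq_of_not_lt hba).symm

theorem IsSetTree.exists_isLeast (hT : IsSetTree T) {t : T} {S : Set T} (hSt : S ⊆ Set.Iic t)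
    (hS : S.Nonempty) : ∃ m, IsLeast S m := by
  rcases (S ∩ Set.Iio t).eq_empty_or_nonempty with hempty | hne
  · have hle : ∀ s ∈ S, t ≤ s := fun s hs =>
      ((hSt hs).eq_of_not_lt fun hlt => Set.notMem_empty s (hempty ▸ ⟨hs, hlt⟩)).ge
    obtain ⟨s, hs⟩ := hS
    exact ⟨t, (hSt hs).antisymm (hle s hs) ▸ hs, hle⟩
  · obtain ⟨m, hm, hmin⟩ := isSetTree_iff_exists_isLeast.1 hT t _ Set.inter_subset_right hne
    refine ⟨m, hm.1, fun s hs => ?_⟩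
    rcases (show s ≤ t from hSt hs).eq_or_lt with rfl | hlt
    · exact hm.2.le
    · exact hmin ⟨hs, hlt⟩

theorem IsSetTree.le_total_of_le (hT : IsSetTree T) {s s' t : T} (hs : s ≤ t) (hs' : s' ≤ t) :
    s ≤ s' ∨ s' ≤ s := by
  obtain ⟨m, rfl | rfl, hmin⟩ :=
    hT.exists_isLeast (Set.pair_subset hs hs') (Set.insert_nonempty _ _)
  · exact Or.inl (hmin (Or.inr rfl))
  · exact Or.inr (hmin (Or.inl rfl))

theorem isSetTree_of_wellFoundedLT_key {K : Type*} [LinearOrder K] [WellFoundedLT K] (k : T → K)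
    (hk : ∀ s s' t : T, s ≤ t → s' ≤ t → k s ≤ k s' → s ≤ s') : IsSetTree T := by
  refine isSetTree_iff_exists_isLeast.2 fun t S hSt hS => ?_
  obtain ⟨m, hm, hmin⟩ := (InvImage.wf k wellFounded_lt).has_min S hS
  exact ⟨m, hm, fun s hs => hk m s t (hSt hm).le (hSt hs).le (not_lt.1 (hmin s hs))⟩

theorem exists_uncountable_branch_iff :
    (∃ b : Set T, IsBranch b ∧ ¬ b.Countable) ↔
      ∃ c : Set T, IsChain (· ≤ ·) c ∧ ¬ c.Countable := by
  refine ⟨fun ⟨b, hb, hbc⟩ => ⟨b, hb.1, hbc⟩, fun ⟨c, hc, hcc⟩ => ?_⟩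
  obtain ⟨b, hb, hcb⟩ := hc.exists_maxChain
  exact ⟨b, hb, fun hbc => hcc (hbc.mono hcb)⟩

variable (T) in
/-- The comparability graph of a partial order, in which distinct comparable elements are adjacent.
It turns a tree into a graph whose countable colorings are the specializing functions. -/
def comparabilityGraph : SimpleGraph T := SimpleGraph.fromRel (· ≤ ·)

theorem isSpecial_iff_nonempty_coloring :
    IsSpecial T ↔ Nonempty ((comparabilityGraph T).Coloring ℕ) := by
  constructor
  · rintro ⟨f, hf⟩
    refine ⟨SimpleGraph.Coloring.mk f fun {s t} hst heq => hst.1 ?_⟩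
    have hchain : IsChain (· ≤ ·) {s, t} := by
      rcases hst.2 with h | h
      · exact IsChain.pair h
      · exact Set.pair_comm s t ▸ IsChain.pair h
    exact hf _ hchain (Or.inl rfl) (Or.inr rfl) heq
  · rintro ⟨f⟩
    refine ⟨f, fun c hc s hs t ht heq => by_contra fun hne => ?_⟩
    exact f.valid (show (comparabilityGraph T).Adj s t from ⟨hne, hc hs ht hne⟩) heq

theorem IsSetTree.exists_isLeast_of_connected (hT : IsSetTree T) {X : Set T}
    (hX : ((comparabilityGraph T).induce X).Connected) : ∃ m, IsLeast X m := by
  obtain ⟨x⟩ := hX.nonempty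
  obtain ⟨m, ⟨hmX, hmx⟩, hmin⟩ :=
    hT.exists_isLeast (S := X ∩ Set.Iic x.1) Set.inter_subset_right ⟨x, x.2, le_rfl⟩
  refine ⟨m, hmX, fun y hy => by_contra fun hmy => ?_⟩
  obtain ⟨p⟩ := hX.preconnected ⟨m, hmX⟩ ⟨y, hy⟩
  obtain ⟨d, -, hfst, hsnd⟩ := p.exists_boundary_dart {z | m ≤ z.1} le_rfl hmy
  rcases d.adj.2 with hle | hge
  · exact hsnd (le_trans hfst hle)
  · rcases hT.le_total_of_le hfst hge with h | h
    · exact hsnd h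
    · exact hsnd (hmin ⟨d.snd.2, h.trans hmx⟩)

theorem IsSetTree.exists_injective_isChain_range_of_isMinor (hT : IsSetTree T) {A : Type*}
    (h : IsMinor (⊤ : SimpleGraph A) (comparabilityGraph T)) :
    ∃ r : A → T, Function.Injective r ∧ IsChain (· ≤ ·) (Set.range r) := by
  obtain ⟨X, hdisj, hconn, hadj⟩ := h
  choose r hr using fun a => hT.exists_isLeast_of_connected (hconn a)
  refine ⟨r, fun a b hab => by_contra fun hne => ?_, ?_⟩
  · exact Set.disjoint_left.1 (hdisj a b hne) (hr a).1 (hab ▸ (hr b).1)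
  · rintro _ ⟨a, rfl⟩ _ ⟨b, rfl⟩ hne
    obtain ⟨x, hx, y, hy, -, hxy | hyx⟩ := hadj a b (ne_of_apply_ne r hne)
    · exact hT.le_total_of_le (((hr a).2 hx).trans hxy) ((hr b).2 hy)
    · exact hT.le_total_of_le ((hr a).2 hx) (((hr b).2 hy).trans hyx)

end Trees

section OmegaOne

instance : Uncountable (ω_ 1 : Ordinal.{u}).ToType := by
  rw [← Cardinal.aleph0_lt_mk_iff]
  simp

instance (a : (ω_ 1 : Ordinal.{u}).ToType) : Countable (Set.Iio a) := by
  rw [← Cardinal.mk_le_aleph0_iff, ← not_lt, ← Cardinal.aleph_one_le_iff, not_le]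
  exact (Cardinal.mk_Iio_lt a (by simp)).trans_eq (by simp)

theorem IsMinor.comap_injective {A A' V : Type*} {F : SimpleGraph A} {F' : SimpleGraph A'}
    {G : SimpleGraph V} (h : IsMinor F' G) (f : F →g F') (hf : Function.Injective f) :
    IsMinor F G :=
  let ⟨X, hdisj, hconn, hadj⟩ := h
  ⟨X ∘ f, fun _ _ hab => hdisj _ _ (hf.ne hab), fun a => hconn (f a),
    fun _ _ hab => hadj _ _ (f.map_adj hab)⟩

theorem isMinor_completeOmegaOne_of_uncountable {A : Type u} [Uncountable A] {V : Type*}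
    {G : SimpleGraph V} (h : IsMinor (⊤ : SimpleGraph A) G) :
    IsMinor completeOmegaOne.{u} G := by
  have hcard : #(ω_ 1 : Ordinal.{u}).ToType ≤ #A := by
    simp [Cardinal.aleph_one_le_iff]
  obtain ⟨f⟩ := hcard
  exact h.comap_injective (SimpleGraph.Embedding.completeGraph f).toHom f.injective

theorem aleph0_lt_chromaticCardinal_iff {V : Type u} {G : SimpleGraph V} :
    ℵ₀ < chromaticCardinal G ↔ IsEmpty (G.Coloring ℕ) := by
  rw [← not_le, ← not_nonempty_iff, not_iff_not]
  constructor
  · intro h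
    obtain ⟨C, hC, ⟨c⟩⟩ := csInf_mem
      (⟨#V, V, rfl, ⟨G.selfColoring⟩⟩ :
        {μ : Cardinal.{u} | ∃ C : Type u, #C = μ ∧ Nonempty (G.Coloring C)}.Nonempty)
    have : Countable C := Cardinal.mk_le_aleph0_iff.1 (hC.trans_le h)
    obtain ⟨e, he⟩ := exists_injective_nat C
    exact ⟨(SimpleGraph.Embedding.completeGraph ⟨e, he⟩).toHom.comp c⟩
  · rintro ⟨c⟩
    exact csInf_le' ⟨ULift.{u} ℕ, by simp,
      ⟨(SimpleGraph.Embedding.completeGraph Equiv.ulift.symm.toEmbedding).toHom.comp c⟩⟩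

theorem specialTreeSizes_subset_hadwigerSizes : specialTreeSizes.{u} ⊆ hadwigerSizes.{u} := by
  rintro μ ⟨T, _, hμ, hT, hspecial, hbranch⟩
  rw [isSpecial_iff_nonempty_coloring, not_nonempty_iff] at hspecial
  refine ⟨T, comparabilityGraph T, hμ, aleph0_lt_chromaticCardinal_iff.2 hspecial, fun hminor => ?_⟩
  obtain ⟨r, hr, hchain⟩ := hT.exists_injective_isChain_range_of_isMinor hminor
  refine hbranch (exists_uncountable_branch_iff.2 ⟨_, hchain, fun hcount => ?_⟩)
  have := hcount.to_subtype
  exact not_countable (Set.rangeFactorization_injective.2 hr).countable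

end OmegaOne

section WellOrderedSets

/-- A well-ordered subset of the linear order `L`. These sets, ordered by end-extension, form a tree
which admits no strictly increasing map to `L`. -/
@[ext]
structure WellOrderedSet (L : Type*) [LinearOrder L] where
  carrier : Set L
  isWF : carrier.IsWF

namespace WellOrderedSet

variable {L : Type*} [LinearOrder L] {s t : WellOrderedSet L} {x y : L}
  {c : Set (WellOrderedSet L)}

instance : PartialOrder (WellOrderedSet L) where
  le s t := s.carrier ⊆ t.carrier ∧ ∀ x ∈ s.carrier, ∀ y ∈ t.carrier, y ≤ x → y ∈ s.carrier
  le_refl _ := ⟨subset_rfl, fun _ _ _ hy _ => hy⟩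
  le_trans _ _ _ hst htr := ⟨hst.1.trans htr.1, fun x hx y hy hyx =>
    hst.2 x hx y (htr.2 x (hst.1 hx) y hy hyx) hyx⟩
  le_antisymm _ _ hst hts := WellOrderedSet.ext (hst.1.antisymm hts.1)

/-- The initial segment of `s` below `x`. -/
def below (s : WellOrderedSet L) (x : L) : WellOrderedSet L :=
  ⟨s.carrier ∩ Set.Iio x, s.isWF.mono Set.inter_subset_left⟩

theorem below_mono (s : WellOrderedSet L) : Monotone s.below := fun _ _ hxy =>
  ⟨Set.inter_subset_inter_right _ (Set.Iio_subset_Iio hxy),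
    fun _ hz _ hw hwz => ⟨hw.1, hwz.trans_lt hz.2⟩⟩

theorem below_lt (hx : x ∈ s.carrier) : s.below x < s := by
  have hle : s.below x ≤ s := ⟨Set.inter_subset_left, fun _ hz _ hw hwz => ⟨hw, hwz.trans_lt hz.2⟩⟩
  refine hle.lt_of_ne fun heq => lt_irrefl x ?_
  have hx' : x ∈ (s.below x).carrier := by rwa [heq]
  exact hx'.2

theorem below_eq_of_le (hst : s ≤ t) (hx : x ∈ s.carrier) : s.below x = t.below x :=
  WellOrderedSet.ext <| Set.ext fun _ =>
    ⟨fun hy => ⟨hst.1 hy.1, hy.2⟩, fun hy => ⟨hst.2 x hx _ hy.1 hy.2.le, hy.2⟩⟩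

theorem exists_eq_below_of_lt (hst : s < t) : ∃ x ∈ t.carrier, s = t.below x := by
  have hne : (t.carrier \ s.carrier).Nonempty := Set.sdiff_nonempty.2 fun hts =>
    hst.ne (WellOrderedSet.ext (hst.le.1.antisymm hts))
  have hwf := t.isWF.mono (Set.sdiff_subset (t := s.carrier))
  obtain ⟨hmt, hms⟩ := hwf.min_mem hne
  refine ⟨hwf.min hne, hmt, WellOrderedSet.ext (Set.Subset.antisymm (fun y hy => ?_) ?_)⟩
  · exact ⟨hst.le.1 hy, lt_of_not_ge fun hmy => hms (hst.le.2 y hy _ hmt hmy)⟩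
  · exact fun y hy => by_contra fun hys => hwf.not_lt_min hne ⟨hy.1, hys⟩ hy.2

theorem isSetTree : IsSetTree (WellOrderedSet L) := by
  refine isSetTree_iff_exists_isLeast.2 fun t S hSt ⟨s, hs⟩ => ?_
  have hwf := t.isWF.mono (Set.inter_subset_left (t := {x | t.below x ∈ S}))
  have hne : (t.carrier ∩ {x | t.below x ∈ S}).Nonempty := by
    obtain ⟨x, hx, rfl⟩ := exists_eq_below_of_lt (hSt hs)
    exact ⟨x, hx, hs⟩
  refine ⟨t.below (hwf.min hne), (hwf.min_mem hne).2, fun r hr => ?_⟩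
  obtain ⟨y, hy, rfl⟩ := exists_eq_below_of_lt (hSt hr)
  exact t.below_mono (hwf.min_le hne ⟨hy, hr⟩)

theorem exists_upperBound_of_isChain (hc : IsChain (· ≤ ·) c) :
    ∃ u ∈ upperBounds c, u.carrier = ⋃ s ∈ c, s.carrier := by
  have hinit : ∀ s ∈ c, ∀ x ∈ s.carrier, ∀ y ∈ ⋃ s ∈ c, s.carrier, y ≤ x → y ∈ s.carrier := by
    intro s hs x hx y hy hyx
    obtain ⟨r, hr, hyr⟩ := Set.mem_iUnion₂.1 hy
    rcases hc.total hs hr with h | h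
    · exact h.2 x hx y hyr hyx
    · exact h.1 hyr
  have hwf : (⋃ s ∈ c, s.carrier).IsWF := by
    refine Set.isWF_iff_no_descending_seq.2 fun f hf hmem => ?_
    obtain ⟨s, hs, hfs⟩ := Set.mem_iUnion₂.1 (hmem 0)
    exact Set.isWF_iff_no_descending_seq.1 s.isWF f hf fun n =>
      hinit s hs _ hfs _ (hmem n) (hf.antitone (Nat.zero_le _))
  exact ⟨⟨_, hwf⟩, fun s hs => ⟨Set.subset_biUnion_of_mem hs, hinit s hs⟩, rfl⟩

theorem exists_below_eq_of_forall_lt (hs : ∀ y ∈ s.carrier, y < x) :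
    ∃ t : WellOrderedSet L, t.carrier = insert x s.carrier ∧ t.below x = s := by
  refine ⟨⟨_, s.isWF.insert x⟩, rfl, WellOrderedSet.ext (Set.ext fun y => ?_)⟩
  exact ⟨fun hy => hy.1.resolve_left hy.2.ne, fun hy => ⟨Or.inr hy, hs y hy⟩⟩

theorem not_strictMono (g : WellOrderedSet L → L) : ¬ StrictMono g := by
  intro hg
  -- The sets enumerated by iterating `g`: each element is the `g`-value of its initial segment.
  obtain ⟨m, hm, hmax⟩ := zorn_le₀ {s : WellOrderedSet L | ∀ x ∈ s.carrier, g (s.below x) = x} (by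
    intro c hcg hc
    obtain ⟨u, hu, huc⟩ := exists_upperBound_of_isChain hc
    refine ⟨u, fun x hx => ?_, hu⟩
    obtain ⟨s, hs, hxs⟩ := Set.mem_iUnion₂.1 (huc ▸ hx)
    rw [← below_eq_of_le (hu hs) hxs, hcg hs x hxs])
  have hlt : ∀ x ∈ m.carrier, x < g m := fun x hx => (hm x hx).symm.trans_lt (hg (below_lt hx))
  obtain ⟨t, htm, hbelow⟩ := exists_below_eq_of_forall_lt hlt
  have hmt : m < t := hbelow ▸ below_lt (htm ▸ Set.mem_insert _ _)
  have ht : ∀ x ∈ t.carrier, g (t.below x) = x := by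
    rw [htm]
    rintro x (rfl | hx)
    · rw [hbelow]
    · rw [← below_eq_of_le hmt.le hx, hm x hx]
  exact hmt.not_ge (hmax ht hmt.le)

theorem countable_of_isChain (hL : ∀ s : Set L, s.IsWF → s.Countable) (hc : IsChain (· ≤ ·) c) :
    c.Countable := by
  obtain ⟨u, hu, -⟩ := exists_upperBound_of_isChain hc
  refine (((hL _ u.isWF).image u.below).insert u).mono fun s hs => ?_
  rcases (hu hs).eq_or_lt with rfl | hlt
  · exact Set.mem_insert _ _
  · obtain ⟨x, hx, rfl⟩ := exists_eq_below_of_lt hlt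
    exact Or.inr ⟨x, hx, rfl⟩

end WellOrderedSet

theorem countable_of_isWF_of_strictMono {L X : Type*} [LinearOrder L] [LinearOrder X]
    [TopologicalSpace X] [OrderTopology X] [SecondCountableTopology X] {f : L → X}
    (hf : StrictMono f) {s : Set L} (hs : s.IsWF) : s.Countable := by
  have hmax : {x ∈ s | s ∩ Set.Ioi x = ∅}.Subsingleton := fun x hx y hy =>
    le_antisymm (not_lt.1 fun h => Set.notMem_empty x (hy.2 ▸ ⟨hx.1, h⟩))
      (not_lt.1 fun h => Set.notMem_empty y (hx.2 ▸ ⟨hy.1, h⟩))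
  refine ((countable_image_lt_image_Ioi_within s f).union hmax.countable).mono fun x hx => ?_
  rcases (s ∩ Set.Ioi x).eq_empty_or_nonempty with hempty | hne
  · exact Or.inr ⟨hx, hempty⟩
  · have hwf := hs.mono (Set.inter_subset_left (t := Set.Ioi x))
    exact Or.inl ⟨hx, f (hwf.min hne), hf (hwf.min_mem hne).2,
      fun y hy hxy => hf.monotone (hwf.min_le hne ⟨hy, hxy⟩)⟩

theorem strictMono_tsum_indicator {ι : Type*} {f : ι → ℝ} (hf : Summable f)
    (hpos : ∀ i, 0 < f i) : StrictMono fun A : Set ι => ∑' i, A.indicator f i := by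
  intro A B hAB
  obtain ⟨i, hiB, hiA⟩ := Set.exists_of_ssubset hAB
  refine Summable.tsum_lt_tsum (i := i) (fun j => ?_) ?_ (hf.indicator A) (hf.indicator B)
  · exact Set.indicator_le_indicator_of_subset hAB.le (fun j => (hpos j).le) j
  · simpa only [Set.indicator_of_notMem hiA, Set.indicator_of_mem hiB] using hpos i

theorem IsSpecial.exists_strictMono {T : Type*} [PartialOrder T] (hspecial : IsSpecial T) :
    ∃ g : T → ℝ, StrictMono g := by
  obtain ⟨f, hf⟩ := hspecial
  refine ⟨_, (strictMono_tsum_indicator summable_geometric_two fun n => by positivity).comp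
    (?_ : StrictMono fun t => f '' Set.Iic t)⟩
  intro s t hst
  refine (Set.ssubset_iff_of_subset (Set.image_mono (Set.Iic_subset_Iic.2 hst.le))).2
    ⟨f t, Set.mem_image_of_mem f le_rfl, ?_⟩
  rintro ⟨r, hr, hrt⟩
  have hrt' : r = t := hf _ (IsChain.pair (hr.trans hst.le)) (Or.inl rfl) (Or.inr rfl) hrt
  exact hst.not_ge (hrt' ▸ hr)

theorem specialTreeSizes_nonempty : specialTreeSizes.{u}.Nonempty := by
  refine ⟨_, WellOrderedSet (ULift.{u} ℝ), inferInstance, rfl, WellOrderedSet.isSetTree, ?_, ?_⟩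
  · intro hspecial
    obtain ⟨g, hg⟩ := hspecial.exists_strictMono
    exact WellOrderedSet.not_strictMono _ (ULift.orderIso.symm.strictMono.comp hg)
  · rw [exists_uncountable_branch_iff]
    rintro ⟨c, hc, hunc⟩
    refine hunc (WellOrderedSet.countable_of_isChain (fun s hs => ?_) hc)
    exact countable_of_isWF_of_strictMono ULift.orderIso.{u}.strictMono hs

end WellOrderedSets

section Components

variable {V : Type*} {G : SimpleGraph V} {R R' S T : Set V} {v w x : V}

variable (G) in
/-- `v` and `w` are joined by a walk inside `R`, that is, they lie in the same component of the
subgraph induced on `R`. Walks of `G` are used because `R` varies along a decreasing family. -/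
def ReachableIn (R : Set V) (v w : V) : Prop := ∃ p : G.Walk v w, ∀ x ∈ p.support, x ∈ R

theorem ReachableIn.refl (hv : v ∈ R) : ReachableIn G R v v :=
  ⟨.nil, by simpa using hv⟩

theorem ReachableIn.symm : ReachableIn G R v w → ReachableIn G R w v :=
  fun ⟨p, hp⟩ => ⟨p.reverse, by simpa using hp⟩

theorem ReachableIn.trans : ReachableIn G R v w → ReachableIn G R w x → ReachableIn G R v x :=
  fun ⟨p, hp⟩ ⟨q, hq⟩ =>
    ⟨p.append q, fun y hy => ((p.mem_support_append_iff q).1 hy).elim (hp y) (hq y)⟩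

theorem ReachableIn.mono (hR : R ⊆ R') : ReachableIn G R v w → ReachableIn G R' v w :=
  fun ⟨p, hp⟩ => ⟨p, fun x hx => hR (hp x hx)⟩

theorem ReachableIn.mem_right : ReachableIn G R v w → w ∈ R :=
  fun ⟨p, hp⟩ => hp w p.end_mem_support

theorem ReachableIn.of_adj (hv : v ∈ R) (hw : w ∈ R) (h : G.Adj v w) : ReachableIn G R v w :=
  ⟨h.toWalk, by simp [hv, hw]⟩

variable (G) in
/-- The component of `v` in the subgraph induced on `R`; it is empty if `v ∉ R`. -/
def component (R : Set V) (v : V) : Set V := {w | ReachableIn G R v w}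

theorem component_eq (h : ReachableIn G R v w) : component G R v = component G R w :=
  Set.ext fun _ => ⟨h.symm.trans, h.trans⟩

variable (G) in
/-- Some edge of `G` joins `S` to `T`. -/
def Touches (S T : Set V) : Prop := ∃ x ∈ S, ∃ y ∈ T, G.Adj x y

theorem Touches.symm : Touches G S T → Touches G T S :=
  fun ⟨x, hx, y, hy, hxy⟩ => ⟨y, hy, x, hx, hxy.symm⟩

theorem ReachableIn.touches_component_sdiff (h : ReachableIn G R' v w) (hv : v ∈ R) (hw : w ∉ R) :
    Touches G (component G R v) (R' \ R) := by
  obtain ⟨p, hp⟩ := h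
  obtain ⟨d, hd, hfst, hsnd⟩ := p.exists_boundary_dart (component G R v) (ReachableIn.refl hv)
    fun hvw => hw (ReachableIn.mem_right hvw)
  refine ⟨d.fst, hfst, d.snd, ⟨hp _ (p.dart_snd_mem_support_of_mem_darts hd), fun hR => hsnd ?_⟩,
    d.adj⟩
  exact ReachableIn.trans hfst (ReachableIn.of_adj (ReachableIn.mem_right hfst) hR d.adj)

theorem exists_countable_connected_superset (hv : v ∈ R) (hS : S.Countable)
    (hSv : S ⊆ component G R v) :
    ∃ K ⊆ component G R v, S ⊆ K ∧ K.Countable ∧ (G.induce K).Connected := by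
  classical
  have hins : insert v S ⊆ component G R v := Set.insert_subset (ReachableIn.refl hv) hSv
  choose p hp using fun s : ↥(insert v S) => hins s.2
  have : Countable ↥(insert v S) := (hS.insert v).to_subtype
  refine ⟨⋃₀ Set.range fun s => {x | x ∈ (p s).support}, ?_, fun s hs => ?_, ?_, ?_⟩
  · rintro x ⟨_, ⟨s, rfl⟩, hx⟩
    exact ⟨(p s).takeUntil x hx, fun y hy => hp s y ((p s).support_takeUntil_subset_support hx hy)⟩
  · exact ⟨_, ⟨⟨s, Or.inr hs⟩, rfl⟩, (p ⟨s, Or.inr hs⟩).end_mem_support⟩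
  · refine (Set.countable_range _).sUnion ?_
    rintro _ ⟨s, rfl⟩
    exact (p s).support.finite_toSet.countable
  · refine SimpleGraph.induce_sUnion_connected_of_pairwise_not_disjoint
      ⟨_, ⟨v, Set.mem_insert v S⟩, rfl⟩ ?_ ?_
    · rintro _ _ ⟨s, rfl⟩ ⟨t, rfl⟩
      exact ⟨v, (p s).start_mem_support, (p t).start_mem_support⟩
    · rintro _ ⟨s, rfl⟩
      exact (p s).connected_induce_support

theorem exists_countable_connected_touches {ι : Type*} [Countable ι] (N : ι → Set V)
    (hv : v ∈ R) :
    ∃ K ⊆ component G R v, K.Countable ∧ (G.induce K).Connected ∧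
      ∀ i, Touches G (component G R v) (N i) → Touches G K (N i) := by
  choose x hxv hxN using fun i : {i // Touches G (component G R v) (N i)} => i.2
  obtain ⟨K, hKv, hxK, hcount, hconn⟩ :=
    exists_countable_connected_superset hv (Set.countable_range x) (Set.range_subset_iff.2 hxv)
  exact ⟨K, hKv, hcount, hconn, fun i hi => ⟨x ⟨i, hi⟩, hxK ⟨_, rfl⟩, hxN ⟨i, hi⟩⟩⟩

variable (G) in
/-- A core `A` of `R` relative to the sets `N i` picks from every component of `R` a countable
connected set which touches all those `N i` that the component touches. -/
structure IsCore {ι : Type*} (R : Set V) (N : ι → Set V) (A : Set V) : Prop where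
  subset : A ⊆ R
  countable : ∀ v ∈ R, (A ∩ component G R v).Countable
  connected : ∀ v ∈ R, (G.induce (A ∩ component G R v)).Connected
  touches : ∀ v ∈ R, ∀ i, Touches G (component G R v) (N i) →
    Touches G (A ∩ component G R v) (N i)

variable (G R) in
theorem exists_isCore {ι : Type*} [Countable ι] (N : ι → Set V) : ∃ A, IsCore G R N A := by
  have hcore : ∀ C : Set V, (∃ v ∈ R, C = component G R v) →
      ∃ K ⊆ C, K.Countable ∧ (G.induce K).Connected ∧
        ∀ i, Touches G C (N i) → Touches G K (N i) := by
    rintro _ ⟨v, hv, rfl⟩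
    exact exists_countable_connected_touches N hv
  choose! K hKC hcount hconn htouch using hcore
  have hinter : ∀ v ∈ R, (⋃ w ∈ R, K (component G R w)) ∩ component G R v =
      K (component G R v) := by
    refine fun v hv => Set.Subset.antisymm ?_ fun x hx => ?_
    · rintro x ⟨hx, hvx⟩
      obtain ⟨w, hw, hxw⟩ := Set.mem_iUnion₂.1 hx
      rwa [component_eq (ReachableIn.trans hvx (ReachableIn.symm (hKC _ ⟨w, hw, rfl⟩ hxw)))]
    · exact ⟨Set.mem_biUnion hv hx, hKC _ ⟨v, hv, rfl⟩ hx⟩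
  refine ⟨⋃ w ∈ R, K (component G R w), Set.iUnion₂_subset fun w hw x hx => ?_,
    fun v hv => ?_, fun v hv => ?_, fun v hv => ?_⟩
  · exact ReachableIn.mem_right (hKC _ ⟨w, hw, rfl⟩ hx)
  · exact (hinter v hv).symm ▸ hcount _ ⟨v, hv, rfl⟩
  · exact (hinter v hv).symm ▸ hconn _ ⟨v, hv, rfl⟩
  · exact (hinter v hv).symm ▸ htouch _ ⟨v, hv, rfl⟩

end Components

section Layerings

theorem exists_forall_of_wellFoundedLT {I X : Type*} [Preorder I] [WellFoundedLT I]
    {P : ∀ a : I, (Set.Iio a → X) → X → Prop} (h : ∀ a f, ∃ x, P a f x) :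
    ∃ U : I → X, ∀ a, P a (fun b => U b) (U a) := by
  choose F hF using h
  have hfix := (wellFounded_lt (α := I)).fix_eq (C := fun _ => X) fun a rec =>
    F a fun b => rec b b.2
  exact ⟨_, fun a => (hfix a).symm ▸ hF a _⟩

variable {I V : Type*} [Preorder I] {G : SimpleGraph V} {U : I → Set V} {a : I} {v : V}

/-- The vertices which lie in none of the layers before `a`. -/
def remainder (U : I → Set V) (a : I) : Set V := (⋃ b : Set.Iio a, U b)ᶜ

theorem mem_remainder : v ∈ remainder U a ↔ ∀ b < a, v ∉ U b := by
  simp [remainder]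

theorem remainder_anti : Antitone (remainder U) := fun _ _ hba _ hv =>
  mem_remainder.2 fun c hc => mem_remainder.1 hv c (hc.trans_le hba)

variable (G U) in
/-- Each layer `U a` is a core of what remains before `a`, relative to the earlier layers. -/
def IsLayering : Prop := ∀ a, IsCore G (remainder U a) (fun b : Set.Iio a => U b) (U a)

variable (G I) in
theorem exists_isLayering [WellFoundedLT I] [∀ a : I, Countable (Set.Iio a)] :
    ∃ U : I → Set V, IsLayering G U :=
  exists_forall_of_wellFoundedLT fun _ f => exists_isCore G (⋃ b, f b)ᶜ f

theorem IsLayering.eq_of_mem {I : Type*} [LinearOrder I] {U : I → Set V} {a b : I}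
    (hU : IsLayering G U) (ha : v ∈ U a) (hb : v ∈ U b) : a = b := by
  rcases lt_trichotomy a b with hab | hab | hba
  · exact absurd ha (mem_remainder.1 ((hU b).subset hb) a hab)
  · exact hab
  · exact absurd hb (mem_remainder.1 ((hU a).subset ha) b hba)

variable (G U) in
/-- The part of the layer `U a` in the component of `v` of what remains before `a`. These are the
branch sets of the `K_{ω₁}` minor. -/
def bag (a : I) (v : V) : Set V := U a ∩ component G (remainder U a) v

end Layerings

section UncountableOrders

theorem countable_Iic {I : Type*} [PartialOrder I] (a : I) [Countable (Set.Iio a)] :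
    (Set.Iic a).Countable :=
  Set.Iio_insert (a := a) ▸ (Set.to_countable (Set.Iio a)).insert a

variable {I : Type*} [LinearOrder I] [Uncountable I] [∀ a : I, Countable (Set.Iio a)]

theorem exists_forall_lt_of_countable {S : Set I} (hS : S.Countable) : ∃ d, ∀ s ∈ S, s < d := by
  by_contra! hcofinal
  refine Set.not_countable_univ ((hS.biUnion fun s _ => countable_Iic s).mono fun d _ => ?_)
  exact Set.mem_iUnion₂.2 (by simpa using hcofinal d)

theorem exists_gt_forall_lt_map_lt [WellFoundedLT I] (f : I → I) (a : I) :
    ∃ d, a < d ∧ ∀ b < d, f b < d := by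
  have hstep : ∀ b : I, ∃ c, ∀ e ≤ b, f e < c := fun b => by
    obtain ⟨c, hc⟩ := exists_forall_lt_of_countable ((countable_Iic b).image f)
    exact ⟨c, fun e he => hc _ ⟨e, he, rfl⟩⟩
  choose s hs using hstep
  -- The least strict upper bound of the iterates `s^[n] a` is closed under `f`.
  have hbound := exists_forall_lt_of_countable (Set.countable_range fun n : ℕ => s^[n] a)
  obtain ⟨d, hd, hmin⟩ := (wellFounded_lt (α := I)).has_min
    {d | ∀ n : ℕ, s^[n] a < d} (by simpa [Set.Nonempty] using hbound)
  refine ⟨d, hd 0, fun b hb => ?_⟩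
  obtain ⟨n, hn⟩ : ∃ n : ℕ, b ≤ s^[n] a := by
    by_contra! hlt
    exact hmin b hlt hb
  calc f b < s^[n + 1] a := Function.iterate_succ_apply' s n a ▸ hs _ b hn
    _ < d := hd _

end UncountableOrders

section Threads

variable {I V : Type*} [Preorder I] {G : SimpleGraph V} {U : I → Set V} {v : I → V} {a b : I}

variable (G U v) in
/-- The vertices `v a` represent a decreasing sequence of components, one component of
`remainder U a` for each `a`. -/
def IsThread : Prop := ∀ ⦃b a⦄, b ≤ a → ReachableIn G (remainder U b) (v b) (v a)

theorem IsThread.apply_mem_remainder (hv : IsThread G U v) (a : I) : v a ∈ remainder U a :=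
  (hv le_rfl).mem_right

theorem IsThread.component_anti (hv : IsThread G U v) :
    Antitone fun a => component G (remainder U a) (v a) :=
  fun _ _ hba _ hx => (hv hba).trans (ReachableIn.mono (remainder_anti hba) hx)

variable (G U v) in
/-- The layer `U b` is touched by all later components of the thread `v`. -/
def IsPersistent (b : I) : Prop := ∀ a, b < a → Touches G (component G (remainder U a) (v a)) (U b)

theorem IsPersistent.touches_bag (hb : IsPersistent G U v b) (hU : IsLayering G U)
    (hv : IsThread G U v) (hba : b < a) : Touches G (bag G U a (v a)) (bag G U b (v b)) := by
  obtain ⟨x, hx, y, hy, hxy⟩ := (hU a).touches _ (hv.apply_mem_remainder a) ⟨b, hba⟩ (hb a hba)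
  have hxb : ReachableIn G (remainder U b) (v b) x := hv.component_anti hba.le hx.2
  exact ⟨x, hx, y, ⟨hy, hxb.trans (.of_adj hxb.mem_right ((hU b).subset hy) hxy)⟩, hxy⟩

end Threads

section PersistentLayers

variable {I : Type u} {V : Type*} [LinearOrder I] [WellFoundedLT I] [Uncountable I]
  [∀ a : I, Countable (Set.Iio a)] {G : SimpleGraph V} {U : I → Set V} {v : I → V}

theorem IsThread.exists_isPersistent_ge (hv : IsThread G U v) (hU : IsLayering G U) (a : I) :
    ∃ b, a ≤ b ∧ IsPersistent G U v b := by
  by_contra! hnone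
  have hlost : ∀ b, a ≤ b → ∃ c, ¬ Touches G (component G (remainder U c) (v c)) (U b) :=
    fun b hab => by
      by_contra! htouch
      exact hnone b hab fun c _ => htouch c
  have : Nonempty I := ⟨a⟩
  choose! f hf using hlost
  obtain ⟨d, had, hd⟩ := exists_gt_forall_lt_map_lt f a
  obtain ⟨⟨u, hua, hu⟩⟩ := ((hU a).connected _ (hv.apply_mem_remainder a)).nonempty
  have hud : u ∉ remainder U d := fun hud => mem_remainder.1 hud a had hua
  obtain ⟨x, hx, y, ⟨hya, hyd⟩, hxy⟩ :=
    ((hv had.le).symm.trans hu).touches_component_sdiff (hv.apply_mem_remainder d) hud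
  obtain ⟨b, hbd, hyb⟩ : ∃ b < d, y ∈ U b := by simpa [remainder] using hyd
  have hab : a ≤ b := not_lt.1 fun hba => mem_remainder.1 hya b hba hyb
  exact hf b hab ⟨x, hv.component_anti (hd b hbd).le hx, y, hyb, hxy⟩

theorem IsThread.isMinor (hv : IsThread G U v) (hU : IsLayering G U) :
    IsMinor completeOmegaOne.{u} G := by
  have : Uncountable {b // IsPersistent G U v b} := by
    refine not_countable_iff.1 fun hcount => ?_
    obtain ⟨d, hd⟩ := exists_forall_lt_of_countable (Set.countable_coe_iff.1 hcount)
    obtain ⟨b, hdb, hb⟩ := hv.exists_isPersistent_ge hU d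
    exact (hd b hb).not_ge hdb
  refine isMinor_completeOmegaOne_of_uncountable (A := {b // IsPersistent G U v b})
    ⟨fun b => bag G U b (v b), fun a b hab => ?_, fun b => ?_, fun a b hab => ?_⟩
  · exact Set.disjoint_left.2 fun x hxa hxb => hab (Subtype.ext (hU.eq_of_mem hxa.1 hxb.1))
  · exact (hU b).connected _ (hv.apply_mem_remainder b)
  · rcases lt_or_gt_of_ne hab.ne with hlt | hgt
    · exact (a.2.touches_bag hU hv hlt).symm
    · exact b.2.touches_bag hU hv hgt

end PersistentLayers

section Rankings

variable {I V : Type*} [PartialOrder I] {G : SimpleGraph V} {U : I → Set V} {k : V → I ×ₗ ℕ}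
  {v w x : V}

/-- The index of the layer of `v` according to the ranking `k`. -/
def level (k : V → I ×ₗ ℕ) (v : V) : I := (ofLex (k v)).1

theorem level_mono (h : k v ≤ k w) : level k v ≤ level k w :=
  Prod.Lex.monotone_fst _ _ h

variable (G U k) in
/-- A ranking of the vertices by layers, refined by a countable index within each bag. -/
structure IsRanking : Prop where
  mem_layer : ∀ v, v ∈ U (level k v)
  eq_of_reachableIn : ∀ v w, ReachableIn G (remainder U (level k v)) v w → k v = k w → v = w

theorem IsLayering.exists_isRanking (hU : IsLayering G U) (hcover : ∀ v, ∃ a, v ∈ U a) :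
    ∃ k, IsRanking G U k := by
  choose l hl using hcover
  have hindex : ∀ K : Set V, K.Countable → ∃ f : V → ℕ, Set.InjOn f K :=
    fun K => Set.countable_iff_exists_injOn.1
  choose! f hf using hindex
  refine ⟨fun v => toLex (l v, f (bag G U (l v) v) v), hl, fun v w hvw heq => ?_⟩
  obtain ⟨hlevel, hfeq⟩ := Prod.ext_iff.1 (toLex.injective heq)
  change ReachableIn G (remainder U (l v)) v w at hvw
  change l v = l w at hlevel
  change f (bag G U (l v) v) v = f (bag G U (l w) w) w at hfeq
  have hv : v ∈ remainder U (l v) := (hU (l v)).subset (hl v)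
  have hbag : bag G U (l w) w = bag G U (l v) v := by
    rw [bag, bag, ← hlevel, component_eq hvw]
  rw [hbag] at hfeq
  exact hf _ ((hU (l v)).countable v hv) ⟨hl v, .refl hv⟩ ⟨hlevel ▸ hl w, hvw⟩ hfeq

variable (G U k) in
/-- The tree order: `w` lies in the component of `v` of what remains before the layer of `v`, and
`v` does not come after `w` in the ranking. -/
def LayerLE (v w : V) : Prop := ReachableIn G (remainder U (level k v)) v w ∧ k v ≤ k w

theorem LayerLE.trans (hvw : LayerLE G U k v w) (hwx : LayerLE G U k w x) : LayerLE G U k v x :=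
  ⟨hvw.1.trans (hwx.1.mono (remainder_anti (level_mono hvw.2))), hvw.2.trans hwx.2⟩

theorem LayerLE.of_key_le (hv : LayerLE G U k v x) (hw : LayerLE G U k w x) (h : k v ≤ k w) :
    LayerLE G U k v w :=
  ⟨hv.1.trans (hw.1.mono (remainder_anti (level_mono h))).symm, h⟩

theorem IsRanking.mem_remainder_level (hk : IsRanking G U k) (hU : IsLayering G U) (v : V) :
    v ∈ remainder U (level k v) :=
  (hU _).subset (hk.mem_layer v)

/-- The tree order on the vertices, as an instance to be supplied locally. -/
@[reducible]
def IsRanking.partialOrder (hk : IsRanking G U k) (hU : IsLayering G U) : PartialOrder V where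
  le := LayerLE G U k
  le_refl v := ⟨.refl (hk.mem_remainder_level hU v), le_rfl⟩
  le_trans _ _ _ := LayerLE.trans
  le_antisymm v w hvw hwv := hk.eq_of_reachableIn v w hvw.1 (hvw.2.antisymm hwv.2)

end Rankings

section LinearRankings

variable {I V : Type*} [LinearOrder I] {G : SimpleGraph V} {U : I → Set V} {k : V → I ×ₗ ℕ}
  {v w : V}

theorem IsRanking.layerLE_of_adj (hk : IsRanking G U k) (hU : IsLayering G U) (hvw : G.Adj v w) :
    LayerLE G U k v w ∨ LayerLE G U k w v := by
  have hmem := hk.mem_remainder_level hU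
  have of_key_le : ∀ {v w}, G.Adj v w → k v ≤ k w → LayerLE G U k v w := fun hvw h =>
    ⟨.of_adj (hmem _) (remainder_anti (level_mono h) (hmem _)) hvw, h⟩
  exact (le_total (k v) (k w)).imp (of_key_le hvw) (of_key_le hvw.symm)

variable [∀ a : I, Countable (Set.Iio a)] {c : Set V}

theorem IsRanking.exists_le_level_of_isChain (hk : IsRanking G U k)
    (hc : IsChain (LayerLE G U k) c) (hunc : ¬ c.Countable) (a : I) : ∃ v ∈ c, a ≤ level k v := by
  by_contra! hlt
  refine hunc (Set.MapsTo.countable_of_injOn (f := fun v => ofLex (k v))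
    (t := Set.Iio a ×ˢ Set.univ) (fun v hv => ⟨hlt v hv, trivial⟩) (fun v hv w hw heq => ?_)
    ((Set.to_countable _).prod Set.countable_univ))
  have hkey : k v = k w := ofLex.injective heq
  by_contra hne
  rcases hc hv hw hne with hvw | hwv
  · exact hne (hk.eq_of_reachableIn v w hvw.1 hkey)
  · exact hne (hk.eq_of_reachableIn w v hwv.1 hkey.symm).symm

theorem IsRanking.exists_isThread_of_isChain (hk : IsRanking G U k) (hU : IsLayering G U)
    (hc : IsChain (LayerLE G U k) c) (hunc : ¬ c.Countable) : ∃ v : I → V, IsThread G U v := by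
  choose v hvc hv using hk.exists_le_level_of_isChain hc hunc
  refine ⟨v, fun b a hba => ?_⟩
  rcases eq_or_ne (v b) (v a) with heq | hne
  · exact heq ▸ .refl (remainder_anti (hv b) (hk.mem_remainder_level hU (v b)))
  · rcases hc (hvc b) (hvc a) hne with h | h
    · exact h.1.mono (remainder_anti (hv b))
    · exact (h.1.mono (remainder_anti (hba.trans (hv a)))).symm

end LinearRankings

theorem exists_isSetTree_le_comparabilityGraph {V : Type*} {G : SimpleGraph V}
    (hminor : ¬ IsMinor completeOmegaOne.{u} G) :
    ∃ _ : PartialOrder V, IsSetTree V ∧ G ≤ comparabilityGraph V ∧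
      ∀ c : Set V, IsChain (· ≤ ·) c → c.Countable := by
  obtain ⟨U, hU⟩ := exists_isLayering (ω_ 1 : Ordinal.{u}).ToType G
  have hcover : ∀ v, ∃ a, v ∈ U a := fun v => by
    by_contra! hv
    have hthread : IsThread G U fun _ => v := fun b _ _ =>
      .refl (mem_remainder.2 fun c _ => hv c)
    exact hminor (hthread.isMinor hU)
  obtain ⟨k, hk⟩ := hU.exists_isRanking hcover
  let := hk.partialOrder hU
  refine ⟨this, isSetTree_of_wellFoundedLT_key k fun _ _ _ => LayerLE.of_key_le,
    fun v w hvw => ⟨hvw.ne, hk.layerLE_of_adj hU hvw⟩, fun c hc => by_contra fun hunc => ?_⟩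
  obtain ⟨v, hv⟩ := hk.exists_isThread_of_isChain hU hc hunc
  exact hminor (hv.isMinor hU)

theorem hadwigerSizes_subset_specialTreeSizes : hadwigerSizes.{u} ⊆ specialTreeSizes.{u} := by
  rintro μ ⟨V, G, hμ, hχ, hminor⟩
  obtain ⟨order, hT, hG, hchain⟩ := exists_isSetTree_le_comparabilityGraph hminor
  refine ⟨V, order, hμ, hT, fun hspecial => ?_, ?_⟩
  · obtain ⟨f⟩ := isSpecial_iff_nonempty_coloring.1 hspecial
    exact (aleph0_lt_chromaticCardinal_iff.1 hχ).false (f.comp (SimpleGraph.Hom.ofLE hG))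
  · rw [exists_uncountable_branch_iff]
    exact fun ⟨c, hc, hunc⟩ => hunc (hchain c hc)

theorem hadwigerSizes_eq_specialTreeSizes : hadwigerSizes.{u} = specialTreeSizes.{u} :=
  hadwigerSizes_subset_specialTreeSizes.antisymm specialTreeSizes_subset_hadwigerSizes

end UncountableHadwiger

/-- Both least sizes exist, and they are equal. -/
theorem mainTheorem2 :
    UncountableHadwiger.hadwigerSizes.{u}.Nonempty ∧
    UncountableHadwiger.specialTreeSizes.{u}.Nonempty ∧
    UncountableHadwiger.hadwigerNumber.{u} = UncountableHadwiger.specialTreeNumber.{u} := by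
  have heq := UncountableHadwiger.hadwigerSizes_eq_specialTreeSizes.{u}
  have hne := UncountableHadwiger.specialTreeSizes_nonempty.{u}
  exact ⟨heq ▸ hne, hne, congrArg sInf heq⟩
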